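/- Let $R$ be a commutative Noetherian local ring with maximal ideal $\mathfrak m$ and $\mathfrak m$-adic completion $\widehat R$, and let $n\ge 0$ be an integer. For $A\in\{R,\widehat R\}$, let $\mathrm{fl}(A)$ be the category of $A$-modules of finite length, let $\Omega^n\,\mathrm{fl}(A)$ consist of the finitely generated $A$-modules that are isomorphic to an $n$-th syzygy of a module in $\mathrm{fl}(A)$ (a first syzygy of $M$ is a kernel of a surjection $P\to M$ with $P$ a finitely generated projective $A$-module; $n$-th syzygies are obtained by iterating, the zeroth syzygy being $M$ itself), and let $\operatorname{add}\Omega^n\,\mathrm{fl}(A)$ consist of all direct summands of finite direct sums of modules in $\Omega^n\,\mathrm{fl}(A)$. Say that a class of modules has finite (resp. countable) representation type if it contains only finitely (resp. at most countably) many indecomposable modules up to isomorphism. Then: (a) $\operatorname{add}\Omega^n\,\mathrm{fl}(R)$ has finite representation type if and only if $\operatorname{add}\Omega^n\,\mathrm{fl}(\widehat R)$ has finite representation type; (b) $\operatorname{add}\Omega^n\,\mathrm{fl}(R)$ has countable representation type if and only if $\operatorname{add}\Omega^n\,\mathrm{fl}(\widehat R)$ has countable representation type. -/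

import Mathlib

open CategoryTheory

universe u

namespace SyzygyRep

variable (R : Type u) [CommRing R]

/-- `fl(R)`: the modules of finite length (over any ring these are finitely generated). -/
def finiteLength : ObjectProperty (ModuleCat.{u} R) := fun M => IsFiniteLength R M

variable {R}

/-- `N` is a first syzygy of `M`: there is a short exact sequence `0 → N → P → M → 0` with `P` a
finitely generated projective module.  Syzygies are determined by `M` only up to projective
summands, and every choice of `P` is allowed. -/
def IsFirstSyzygy (N M : ModuleCat.{u} R) : Prop :=
  ∃ (P : ModuleCat.{u} R) (f : N →ₗ[R] P) (g : P →ₗ[R] M),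
    Module.Finite R P ∧ Module.Projective R P ∧
      Function.Injective f ∧ Function.Exact f g ∧ Function.Surjective g

/-- `N` is an `n`-th syzygy of `M`; the zeroth syzygy is `M` itself, up to isomorphism, and an
`(n + 1)`-st syzygy is a first syzygy of an `n`-th syzygy. -/
def IsSyzygy : ℕ → ModuleCat.{u} R → ModuleCat.{u} R → Prop
  | 0, N, M => Nonempty (N ≅ M)
  | n + 1, N, M => ∃ K : ModuleCat.{u} R, IsSyzygy n K M ∧ IsFirstSyzygy N K

/-- `Ωⁿ 𝒳`: the finitely generated modules that are an `n`-th syzygy of some module in `𝒳`. -/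
def syzygies (n : ℕ) (𝒳 : ObjectProperty (ModuleCat.{u} R)) : ObjectProperty (ModuleCat.{u} R) :=
  fun N => Module.Finite R N ∧ ∃ X : ModuleCat.{u} R, 𝒳 X ∧ IsSyzygy n N X

/-- `add 𝒳`: the finitely generated modules that are direct summands of finite direct sums of
modules in `𝒳`. -/
def addClosure (𝒳 : ObjectProperty (ModuleCat.{u} R)) : ObjectProperty (ModuleCat.{u} R) :=
  fun M => Module.Finite R M ∧
    ∃ (m : ℕ) (X : Fin m → ModuleCat.{u} R) (N : ModuleCat.{u} R),
      (∀ i, 𝒳 (X i)) ∧ Nonempty ((M × N) ≃ₗ[R] (∀ i, X i))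

/-- The set of isomorphism classes of indecomposable modules belonging to `𝒳`. -/
def indecomposableClasses (𝒳 : ObjectProperty (ModuleCat.{u} R)) :
    Set (Quotient (isIsomorphicSetoid (ModuleCat.{u} R))) :=
  {c | ∃ M : ModuleCat.{u} R, 𝒳 M ∧ Indecomposable M ∧ Quotient.mk _ M = c}

/-- There are only finitely many isomorphism classes of indecomposable modules in `𝒳`. -/
def HasFiniteRepType (𝒳 : ObjectProperty (ModuleCat.{u} R)) : Prop :=
  (indecomposableClasses 𝒳).Finite

/-- There are only countably (that is, at most countably) many isomorphism classes of
indecomposable modules in `𝒳`. -/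
def HasCountableRepType (𝒳 : ObjectProperty (ModuleCat.{u} R)) : Prop :=
  (indecomposableClasses 𝒳).Countable

end SyzygyRep

/-! Write `S` for the completion of `R`; the proof compares `R` with `S` through `L ↦ S ⊗ L`. Every
`S`-module of finite length is the base change of its restriction to `R`, and by flatness base
change preserves syzygies. Conversely, a first syzygy of `S ⊗ K` descends to `R`: the surjection
from a free module may be replaced by the base change of an `R`-linear map congruent to it modulo
the maximal ideal, without changing the kernel up to isomorphism. So each module in the class over
`S` is a summand of a base change from the class over `R`.

Over `S` the Krull–Schmidt theorem holds, because finitely generated indecomposables have local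
endomorphism rings. Hence each indecomposable over `S` in the class is a summand of `S ⊗ L` for an
indecomposable `L` over `R`, and each `S ⊗ L` has only finitely many such summands. This passes both
properties from `R` to `S`.

For the converse, attach to `L` the vector `F L` of multiplicities of the indecomposable summands of
`S ⊗ L`. If `F L ≤ F L'`, then `S ⊗ L` is a summand of `S ⊗ L'`, so `L` is a summand of `L'`
(`isDirectSummand_of_baseChange`), and `L ≅ L'` by indecomposability. Thus `F` is injective with an
antichain as image. Dickson's lemma settles the finite case, and countability of the finitely
supported vectors settles the other. Krull–Schmidt uniqueness over `R`, which may fail, is never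
needed. -/

/-- `M` is isomorphic to a direct summand of `N`. -/
def IsDirectSummand (A : Type*) [Semiring A] (M N : Type*) [AddCommMonoid M] [AddCommMonoid N]
    [Module A M] [Module A N] : Prop :=
  ∃ (i : M →ₗ[A] N) (p : N →ₗ[A] M), p ∘ₗ i = LinearMap.id

namespace IsDirectSummand

section Semiring

variable {A : Type*} [Semiring A] {M N L : Type*} [AddCommMonoid M] [AddCommMonoid N]
  [AddCommMonoid L] [Module A M] [Module A N] [Module A L]

theorem of_equiv (e : M ≃ₗ[A] N) : IsDirectSummand A M N :=
  ⟨e, e.symm, by ext; simp⟩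

theorem trans (h : IsDirectSummand A M N) (h' : IsDirectSummand A N L) :
    IsDirectSummand A M L := by
  obtain ⟨i, p, h⟩ := h
  obtain ⟨i', p', h'⟩ := h'
  refine ⟨i' ∘ₗ i, p ∘ₗ p', LinearMap.ext fun x => ?_⟩
  exact (congrArg p (LinearMap.congr_fun h' (i x))).trans (LinearMap.congr_fun h x)

theorem finite (h : IsDirectSummand A M N) [Module.Finite A N] : Module.Finite A M := by
  obtain ⟨i, p, h⟩ := h
  exact Module.Finite.of_surjective p fun x => ⟨i x, LinearMap.congr_fun h x⟩

theorem prod_left : IsDirectSummand A M (M × N) :=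
  ⟨LinearMap.inl A M N, LinearMap.fst A M N, by ext; simp⟩

theorem prod_right : IsDirectSummand A N (M × N) :=
  ⟨LinearMap.inr A M N, LinearMap.snd A M N, by ext; simp⟩

theorem single {ι : Type*} [DecidableEq ι] (X : ι → Type*) [∀ i, AddCommMonoid (X i)]
    [∀ i, Module A (X i)] (i : ι) : IsDirectSummand A (X i) (∀ i, X i) :=
  ⟨LinearMap.single A X i, LinearMap.proj i, by ext; simp⟩

theorem pi {ι κ : Type*} [Finite ι] (X : ι → Type*) (Y : κ → Type*)
    [∀ i, AddCommMonoid (X i)] [∀ i, Module A (X i)] [∀ i, AddCommMonoid (Y i)]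
    [∀ i, Module A (Y i)] (σ : ι → κ) (hσ : Function.Injective σ)
    (h : ∀ i, IsDirectSummand A (X i) (Y (σ i))) :
    IsDirectSummand A (∀ i, X i) (∀ k, Y k) := by
  classical
  have := Fintype.ofFinite ι
  choose e p hep using h
  refine ⟨∑ k, LinearMap.single A Y (σ k) ∘ₗ e k ∘ₗ LinearMap.proj k,
    LinearMap.pi fun i => p i ∘ₗ LinearMap.proj (σ i), LinearMap.ext fun x => funext fun i => ?_⟩
  have h1 := LinearMap.congr_fun (hep i) (x i)
  simp only [LinearMap.coe_comp, Function.comp_apply, LinearMap.pi_apply, LinearMap.coe_proj,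
    Function.eval, LinearMap.sum_apply, Finset.sum_apply, LinearMap.id_apply,
    LinearMap.coe_single] at h1 ⊢
  rw [Finset.sum_eq_single i, Pi.single_eq_same, h1]
  · intro k _ hk
    exact Pi.single_eq_of_ne (fun h => hk (hσ h).symm) _
  · simp

end Semiring

section Ring

variable {A : Type*} [Ring A] {M N L : Type*} [AddCommGroup M] [AddCommGroup N]
  [AddCommGroup L] [Module A M] [Module A N] [Module A L]

theorem exists_equiv_prod (h : IsDirectSummand A M N) :
    ∃ K : Submodule A N, Nonempty ((M × K) ≃ₗ[A] N) := by
  obtain ⟨i, p, h⟩ := h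
  have hp (x) : p (i x) = x := LinearMap.congr_fun h x
  refine ⟨LinearMap.ker p, ⟨LinearEquiv.ofBijective
    (i.coprod (LinearMap.ker p).subtype) ⟨?_, fun y => ⟨(p y, ⟨y - i (p y), ?_⟩), ?_⟩⟩⟩⟩
  · rw [← LinearMap.ker_eq_bot, LinearMap.ker_eq_bot']
    rintro ⟨x, y, hy⟩ hxy
    simp only [LinearMap.coprod_apply, Submodule.subtype_apply] at hxy
    have hx : x = 0 := by
      have := congrArg p hxy
      rwa [map_add, hp, LinearMap.mem_ker.mp hy, add_zero, map_zero] at this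
    subst hx
    ext <;> simp_all
  · simp [hp]
  · simp

end Ring

theorem baseChange {A : Type*} [CommRing A] {M N : Type*} [AddCommGroup M] [AddCommGroup N]
    [Module A M] [Module A N] (B : Type*) [CommRing B] [Algebra A B]
    (h : IsDirectSummand A M N) :
    IsDirectSummand B (TensorProduct A B M) (TensorProduct A B N) := by
  obtain ⟨i, p, h⟩ := h
  exact ⟨i.baseChange B, p.baseChange B, by rw [← LinearMap.baseChange_comp, h,
    LinearMap.baseChange_id]⟩

end IsDirectSummand

/-! ### Indecomposable modules and decompositions into them -/

theorem indecomposable_iff {A : Type u} [Ring A] (M : ModuleCat.{u} A) :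
    Indecomposable M ↔ Nontrivial M ∧
      ∀ Y Z : ModuleCat.{u} A, Nonempty (M ≃ₗ[A] (Y × Z)) → Subsingleton Y ∨ Subsingleton Z := by
  simp only [Indecomposable, ModuleCat.isZero_iff_subsingleton, not_subsingleton_iff_nontrivial]
  refine and_congr_right fun _ => forall₂_congr fun Y Z => ⟨?_, ?_⟩
  · rintro h ⟨e⟩
    exact h (e.toModuleIso ≪≫ (ModuleCat.biprodIsoProd Y Z).symm)
  · intro h e
    exact h ⟨(e ≪≫ ModuleCat.biprodIsoProd Y Z).toLinearEquiv⟩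

theorem indecomposable_iff_of_linearEquiv {A : Type u} [Ring A] {M N : ModuleCat.{u} A}
    (e : M ≃ₗ[A] N) : Indecomposable M ↔ Indecomposable N := by
  rw [indecomposable_iff, indecomposable_iff]
  refine and_congr e.toEquiv.nontrivial_congr (forall₂_congr fun Y Z => imp_congr ?_ Iff.rfl)
  exact ⟨fun ⟨f⟩ => ⟨e.symm.trans f⟩, fun ⟨f⟩ => ⟨e.trans f⟩⟩

theorem CategoryTheory.Indecomposable.nonempty_linearEquiv_of_isDirectSummand
    {A : Type u} [Ring A] {M N : ModuleCat.{u} A} (hN : Indecomposable N) [Nontrivial M]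
    (h : IsDirectSummand A M N) : Nonempty (M ≃ₗ[A] N) := by
  obtain ⟨K, ⟨e⟩⟩ := h.exists_equiv_prod
  rcases ((indecomposable_iff N).mp hN).2 M (ModuleCat.of A K) ⟨e.symm⟩ with h | h
  · exact absurd h (not_subsingleton M)
  · have : Subsingleton K := h
    have : Unique K := Unique.mk' K
    exact ⟨(LinearEquiv.prodUnique (R := A) (M := M) (M₂ := K)).symm.trans e⟩

theorem CategoryTheory.Indecomposable.eq_zero_or_eq_one_of_isIdempotentElem {A : Type u} [Ring A]
    {M : ModuleCat.{u} A} (hM : Indecomposable M) {e : Module.End A M}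
    (he : IsIdempotentElem e) : e = 0 ∨ e = 1 := by
  have hc := LinearMap.IsIdempotentElem.isCompl he
  rcases ((indecomposable_iff M).mp hM).2 (ModuleCat.of A (LinearMap.range e))
    (ModuleCat.of A (LinearMap.ker e)) ⟨(Submodule.prodEquivOfIsCompl _ _ hc).symm⟩ with h | h
  · left
    ext x
    exact congrArg Subtype.val (Subsingleton.elim (α := LinearMap.range e) ⟨e x, x, rfl⟩ 0)
  · right
    ext x
    have : e (e x - x) = 0 := by
      rw [map_sub, ← Module.End.mul_apply, he, sub_self]
    exact sub_eq_zero.mp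
      (congrArg Subtype.val (Subsingleton.elim (α := LinearMap.ker e) ⟨e x - x, this⟩ 0))

theorem SyzygyRep.addClosure_iff {A : Type u} [CommRing A] {𝒳 : ObjectProperty (ModuleCat.{u} A)}
    {M : ModuleCat.{u} A} :
    SyzygyRep.addClosure 𝒳 M ↔ Module.Finite A M ∧ ∃ (m : ℕ) (X : Fin m → ModuleCat.{u} A),
      (∀ i, 𝒳 (X i)) ∧ IsDirectSummand A M (∀ i, X i) := by
  refine and_congr_right fun _ => exists₂_congr fun m X => ⟨?_, ?_⟩
  · rintro ⟨N, hX, ⟨e⟩⟩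
    exact ⟨hX, IsDirectSummand.prod_left.trans (.of_equiv e)⟩
  · rintro ⟨hX, h⟩
    obtain ⟨K, ⟨e⟩⟩ := h.exists_equiv_prod
    exact ⟨ModuleCat.of A K, hX, ⟨e⟩⟩

theorem SyzygyRep.addClosure.of_isDirectSummand {A : Type u} [CommRing A]
    {𝒳 : ObjectProperty (ModuleCat.{u} A)} {M N : ModuleCat.{u} A}
    (hN : SyzygyRep.addClosure 𝒳 N) (h : IsDirectSummand A M N) : SyzygyRep.addClosure 𝒳 M := by
  obtain ⟨hf, m, X, hX, hs⟩ := SyzygyRep.addClosure_iff.mp hN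
  exact SyzygyRep.addClosure_iff.mpr ⟨h.finite, m, X, hX, h.trans hs⟩

theorem finrank_tensorProduct_lt_of_linearEquiv_prod {A : Type*} [CommRing A] (k : Type*)
    [Field k] [Algebra A k] {M Y Z : Type*} [AddCommGroup M] [AddCommGroup Y] [AddCommGroup Z]
    [Module A M] [Module A Y] [Module A Z] [Module.Finite A Y] [Module.Finite A Z]
    [Nontrivial (TensorProduct A k Z)] (e : M ≃ₗ[A] (Y × Z)) :
    Module.finrank k (TensorProduct A k Y) < Module.finrank k (TensorProduct A k M) := by
  rw [((e.baseChange A k).trans (TensorProduct.prodRight A k _ _ _)).finrank_eq,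
    Module.finrank_prod]
  exact Nat.lt_add_of_pos_right Module.finrank_pos

/-- A finitely generated module over a local ring is a finite direct sum of indecomposables. -/
theorem exists_linearEquiv_pi_indecomposable {A : Type u} [CommRing A] [IsLocalRing A]
    (M : ModuleCat.{u} A) [Module.Finite A M] :
    ∃ (k : ℕ) (L : Fin k → ModuleCat.{u} A), (∀ i, Indecomposable (L i)) ∧
      Nonempty (M ≃ₗ[A] ∀ i, L i) := by
  -- Induction on the dimension of the module modulo the maximal ideal: by Nakayama, a nonzero
  -- finitely generated factor contributes a positive dimension, so both factors of a proper
  -- decomposition have smaller dimension.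
  generalize hd : Module.finrank (IsLocalRing.ResidueField A)
    (TensorProduct A (IsLocalRing.ResidueField A) M) = d
  induction d using Nat.strong_induction_on generalizing M with
  | _ d ih =>
  subst hd
  by_cases hM : Indecomposable M
  · exact ⟨1, fun _ => M, fun _ => hM, ⟨(LinearEquiv.funUnique (Fin 1) A M).symm⟩⟩
  rcases subsingleton_or_nontrivial M with hs | hn
  · exact ⟨0, fun _ => M, fun i => i.elim0, ⟨LinearEquiv.ofSubsingleton _ _⟩⟩
  have : ∃ Y Z : ModuleCat.{u} A, Nonempty (M ≃ₗ[A] (Y × Z)) ∧ Nontrivial Y ∧ Nontrivial Z := by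
    by_contra! hcon
    refine hM ((indecomposable_iff M).mpr ⟨hn, fun Y Z h => ?_⟩)
    rw [or_iff_not_imp_left, not_subsingleton_iff_nontrivial]
    exact hcon Y Z h
  obtain ⟨Y, Z, ⟨e⟩, hY, hZ⟩ := this
  have : Module.Finite A (Y × Z) := Module.Finite.equiv e
  have : Module.Finite A Y := IsDirectSummand.finite (N := Y × Z) .prod_left
  have : Module.Finite A Z := IsDirectSummand.finite (N := Y × Z) .prod_right
  rw [← not_subsingleton_iff_nontrivial, ← IsLocalRing.subsingleton_tensorProduct (R := A),
    not_subsingleton_iff_nontrivial] at hY hZ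
  have hY' := finrank_tensorProduct_lt_of_linearEquiv_prod (IsLocalRing.ResidueField A) e
  have hZ' := finrank_tensorProduct_lt_of_linearEquiv_prod (IsLocalRing.ResidueField A)
    (e.trans (LinearEquiv.prodComm A Y Z))
  obtain ⟨k, L, hL, ⟨f⟩⟩ := ih _ hY' Y rfl
  obtain ⟨l, L', hL', ⟨f'⟩⟩ := ih _ hZ' Z rfl
  let W : Fin k ⊕ Fin l → ModuleCat.{u} A := Sum.elim L L'
  refine ⟨k + l, fun i => W (finSumFinEquiv.symm i), fun i => ?_, ⟨?_⟩⟩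
  · exact Sum.rec (motive := fun j => Indecomposable (W j)) hL hL' (finSumFinEquiv.symm i)
  · exact (e.trans (f.prodCongr f')).trans
      ((LinearEquiv.sumPiEquivProdPi A (Fin k) (Fin l) (fun i => W i)).symm.trans
        (LinearEquiv.piCongrLeft A (fun i => W i) finSumFinEquiv.symm).symm)

/-! ### Krull–Schmidt over a complete local ring -/

theorem IsAdicComplete.of_linearEquiv {A : Type*} [CommRing A] {I : Ideal A} {M N : Type*}
    [AddCommGroup M] [AddCommGroup N] [Module A M] [Module A N] [IsAdicComplete I M]
    (e : M ≃ₗ[A] N) : IsAdicComplete I N := by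
  rw [← AdicCompletion.of_bijective_iff]
  have h : ⇑(AdicCompletion.of I N) =
      (AdicCompletion.congr I e) ∘ (AdicCompletion.of I M) ∘ e.symm := by
    ext x : 1
    rw [Function.comp_apply, Function.comp_apply, AdicCompletion.congr_apply,
      AdicCompletion.map_of, LinearEquiv.coe_coe, LinearEquiv.apply_symm_apply]
  rw [h]
  exact (AdicCompletion.congr I e).bijective.comp
    ((AdicCompletion.of_bijective_iff.mpr inferInstance).comp e.symm.bijective)

theorem IsAdicComplete.pi_fin {A : Type*} [CommRing A] {I : Ideal A} [IsAdicComplete I A] (n : ℕ) :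
    IsAdicComplete I (Fin n → A) := by
  rw [← AdicCompletion.of_bijective_iff]
  have h : ⇑(AdicCompletion.of I (Fin n → A)) =
      (AdicCompletion.piEquivFin I n).symm ∘ (fun x i => AdicCompletion.of I A (x i)) := by
    ext x : 1
    rw [Function.comp_apply, LinearEquiv.eq_symm_apply]
    ext i : 1
    rw [AdicCompletion.piEquivFin_apply]
    rfl
  rw [h]
  refine (AdicCompletion.piEquivFin I n).symm.bijective.comp ?_
  have hb : Function.Bijective (AdicCompletion.of I A) :=
    AdicCompletion.of_bijective_iff.mpr inferInstance
  refine ⟨fun x y hxy => funext fun i => hb.1 (congrFun hxy i), fun y => ?_⟩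
  choose x hx using fun i => hb.2 (y i)
  exact ⟨x, funext hx⟩

/-- Nakayama's lemma for a map which is surjective modulo the maximal ideal. -/
theorem LinearMap.surjective_of_forall_sub_mem {A : Type*} [CommRing A] [IsLocalRing A]
    {M N : Type*} [AddCommGroup M] [AddCommGroup N] [Module A M] [Module A N] [Module.Finite A N]
    {f g : M →ₗ[A] N} (hf : Function.Surjective f)
    (h : ∀ x, f x - g x ∈ IsLocalRing.maximalIdeal A • (⊤ : Submodule A N)) :
    Function.Surjective g := by
  rw [← LinearMap.range_eq_top, eq_top_iff]
  refine Submodule.le_of_le_smul_of_le_jacobson_bot Module.Finite.fg_top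
    (IsLocalRing.maximalIdeal_le_jacobson ⊥) fun y _ => ?_
  obtain ⟨x, rfl⟩ := hf y
  rw [← add_sub_cancel (g x) (f x)]
  exact Submodule.add_mem_sup ⟨x, rfl⟩ (h x)

theorem Module.End.isUnit_of_forall_sub_mem {A : Type*} [CommRing A] [IsLocalRing A]
    {M : Type*} [AddCommGroup M] [Module A M] [Module.Finite A M] {f g : Module.End A M}
    (hf : IsUnit f) (h : ∀ x, f x - g x ∈ IsLocalRing.maximalIdeal A • (⊤ : Submodule A M)) :
    IsUnit g :=
  (Module.End.isUnit_iff g).mpr <| OrzechProperty.bijective_of_surjective_endomorphism g <|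
    LinearMap.surjective_of_forall_sub_mem ((Module.End.isUnit_iff f).mp hf).2 h

/-- In a complete finite algebra over a local ring with maximal ideal `m`, each `b` admits an
idempotent `e` which is modulo `m` a multiple of `b` and fixes some power of `b`. -/
theorem exists_isIdempotentElem_sub_mem {A B : Type*} [CommRing A] [IsLocalRing A] [CommRing B]
    [Algebra A B] [Module.Finite A B] [IsAdicComplete (IsLocalRing.maximalIdeal A) B] (b : B) :
    ∃ (n : ℕ) (c e : B), IsIdempotentElem e ∧
      e - b * c ∈ (IsLocalRing.maximalIdeal A).map (algebraMap A B) ∧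
      b ^ n - b ^ n * e ∈ (IsLocalRing.maximalIdeal A).map (algebraMap A B) := by
  set m := IsLocalRing.maximalIdeal A
  set I := m.map (algebraMap A B)
  have : IsAdicComplete I B := (IsAdicComplete.map_algebraMap_iff m B).mpr inferInstance
  let : Algebra (A ⧸ m) (B ⧸ I) := Ideal.Quotient.algebraQuotientOfLEComap Ideal.le_comap_map
  have : IsScalarTower A (A ⧸ m) (B ⧸ I) := .of_algebraMap_eq fun _ => rfl
  have : Module.Finite A (B ⧸ I) :=
    Module.Finite.of_surjective (Ideal.Quotient.mkₐ A I).toLinearMap Ideal.Quotient.mk_surjective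
  have : Module.Finite (A ⧸ m) (B ⧸ I) := Module.Finite.of_restrictScalars_finite A _ _
  let : Field (A ⧸ m) := Ideal.Quotient.field m
  have : IsArtinianRing (B ⧸ I) := IsArtinianRing.of_finite (A ⧸ m) _
  -- `B ⧸ I` is finite over the residue field, so the descending powers of the class `β` of `b`
  -- stabilise: `β ^ (n + 1) * γ = β ^ n`. Then `(β * γ) ^ (n + 1)` is idempotent, and Hensel's
  -- lemma for `X ^ 2 - X` lifts it to `B`.
  obtain ⟨n, y, hy⟩ := IsArtinian.exists_pow_succ_smul_dvd (Ideal.Quotient.mk I b) (1 : B ⧸ I)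
  obtain ⟨c, rfl⟩ := Ideal.Quotient.mk_surjective y
  set β := Ideal.Quotient.mk I b
  set γ := Ideal.Quotient.mk I c
  simp only [smul_eq_mul, mul_one, Nat.succ_eq_add_one] at hy
  have hy' (k : ℕ) : β ^ n * (β * γ) ^ k = β ^ n := by
    induction k with
    | zero => simp
    | succ k ih => rw [pow_succ, ← mul_assoc, ih, ← mul_assoc, ← pow_succ, hy]
  have hidem : (β * γ) ^ (n + 1) * (β * γ) ^ (n + 1) = (β * γ) ^ (n + 1) := by
    conv_rhs => rw [mul_pow, pow_succ, ← hy' (n + 1)]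
    ring
  let f : Polynomial B := Polynomial.X ^ 2 - Polynomial.X
  have hf : f.eval ((b * c) ^ (n + 1)) ∈ I := by
    rw [← Ideal.Quotient.eq_zero_iff_mem]
    simp only [f, Polynomial.eval_sub, Polynomial.eval_pow, Polynomial.eval_X, map_sub, map_pow,
      map_mul]
    rw [sub_eq_zero, sq]
    exact hidem
  have hf' : IsUnit (Ideal.Quotient.mk I (f.derivative.eval ((b * c) ^ (n + 1)))) := by
    have : Ideal.Quotient.mk I (f.derivative.eval ((b * c) ^ (n + 1))) =
        2 * (β * γ) ^ (n + 1) - 1 := by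
      have h2 : f.derivative.eval ((b * c) ^ (n + 1)) = 2 * (b * c) ^ (n + 1) - 1 := by
        simp [f, one_add_one_eq_two]
      rw [h2, map_sub, map_mul, map_pow, map_mul, map_one, map_ofNat]
    rw [this]
    -- For an idempotent `ε`, the derivative `2ε - 1` is its own inverse.
    refine IsUnit.of_mul_eq_one (2 * (β * γ) ^ (n + 1) - 1) ?_
    linear_combination 4 * hidem
  obtain ⟨e, he, hee⟩ := HenselianRing.is_henselian f (by simp only [f]; monicity!) _ hf hf'
  refine ⟨n, c * (b * c) ^ n, e, ?_, ?_, ?_⟩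
  · simp only [f, Polynomial.IsRoot, Polynomial.eval_sub, Polynomial.eval_pow,
      Polynomial.eval_X] at he
    rw [IsIdempotentElem, ← sub_eq_zero, ← he]
    ring
  · convert hee using 2
    ring
  · rw [← Ideal.Quotient.eq_zero_iff_mem] at hee ⊢
    simp only [map_sub, map_pow, map_mul, sub_eq_zero] at hee ⊢
    rw [hee, hy']

/-- The endomorphism ring is local. By Cayley–Hamilton, `φ` is a root of a monic `p`, so `A[X]/(p)`
acts on `M`; this algebra is free of finite rank over `A`, hence complete. The idempotent attached
to the root acts as `0` or `1`. If `0`, a power of `φ` vanishes modulo the maximal ideal and `1 - φ`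
is invertible; if `1`, `φ` is invertible modulo the maximal ideal. Nakayama removes the congruences.
-/
theorem CategoryTheory.Indecomposable.isUnit_or_isUnit_one_sub {A : Type u} [CommRing A]
    [IsLocalRing A] [IsAdicComplete (IsLocalRing.maximalIdeal A) A] {M : ModuleCat.{u} A}
    [Module.Finite A M] (hM : Indecomposable M) (φ : Module.End A M) :
    IsUnit φ ∨ IsUnit (1 - φ) := by
  obtain ⟨p, hp, hpφ⟩ := LinearMap.exists_monic_and_aeval_eq_zero A φ
  let B := AdjoinRoot p
  have : Module.Finite A B := hp.finite_adjoinRoot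
  have := IsAdicComplete.pi_fin (I := IsLocalRing.maximalIdeal A) (AdjoinRoot.powerBasis' hp).dim
  have : IsAdicComplete (IsLocalRing.maximalIdeal A) B :=
    .of_linearEquiv (AdjoinRoot.powerBasis' hp).basis.equivFun.symm
  let F : B →ₐ[A] Module.End A M := Ideal.Quotient.liftₐ (Ideal.span {p}) (Polynomial.aeval φ)
    fun q hq => by
      obtain ⟨r, rfl⟩ := Ideal.mem_span_singleton.mp hq
      rw [map_mul, hpφ, zero_mul]
  have hF : F (AdjoinRoot.root p) = φ := by
    change Polynomial.aeval φ Polynomial.X = φ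
    simp
  have hmem (b : B) (hb : b ∈ (IsLocalRing.maximalIdeal A).map (algebraMap A B)) (x : M) :
      F b x ∈ IsLocalRing.maximalIdeal A • (⊤ : Submodule A M) := by
    induction hb using Submodule.span_induction with
    | mem b hb =>
      obtain ⟨a, ha, rfl⟩ := hb
      rw [AlgHom.commutes, Module.algebraMap_end_apply]
      exact Submodule.smul_mem_smul ha trivial
    | zero => simp
    | add b c _ _ hb hc => simpa using add_mem hb hc
    | smul c b _ hb =>
      rw [smul_eq_mul, map_mul, Module.End.mul_apply]
      have h1 : F b x ∈ IsLocalRing.maximalIdeal A • (⊤ : Submodule A M) := hb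
      have h2 := Submodule.mem_map_of_mem (f := F c) h1
      rw [Submodule.map_smul''] at h2
      exact Submodule.smul_mono le_rfl le_top h2
  obtain ⟨n, c, e, he, h1, h2⟩ := exists_isIdempotentElem_sub_mem (A := A) (AdjoinRoot.root p)
  rcases hM.eq_zero_or_eq_one_of_isIdempotentElem (he.map F) with h | h
  · right
    have hu : IsUnit (1 - φ ^ n) := by
      refine Module.End.isUnit_of_forall_sub_mem (f := 1) isUnit_one fun x => ?_
      have := hmem _ h2 x
      simpa [h, hF] using this
    have hc : Commute (1 - φ) (∑ i ∈ Finset.range n, φ ^ i) :=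
      (Commute.one_left _).sub_left (Commute.sum_right _ _ _ fun i _ => (Commute.refl φ).pow_right i)
    rw [← mul_neg_geom_sum, hc.isUnit_mul_iff] at hu
    exact hu.1
  · left
    have hu : IsUnit (φ * F c) := by
      refine Module.End.isUnit_of_forall_sub_mem (f := 1) isUnit_one fun x => ?_
      have := hmem _ h1 x
      simpa [h, hF] using this
    have hc : Commute φ (F c) := by
      rw [← hF, Commute, SemiconjBy, ← map_mul, mul_comm, map_mul]
    exact (hc.isUnit_mul_iff.mp hu).1

/-- The identity of `M` is the sum of the endomorphisms `φ i` factoring through the `X i`. In a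
local ring one of them must be a unit, which splits `M` off the corresponding `X i`. -/
theorem CategoryTheory.Indecomposable.exists_isDirectSummand_of_pi {A : Type u} [CommRing A]
    [IsLocalRing A] [IsAdicComplete (IsLocalRing.maximalIdeal A) A] {M : ModuleCat.{u} A}
    [Module.Finite A M] (hM : Indecomposable M) {ι : Type*} [Finite ι] (X : ι → Type*)
    [∀ i, AddCommGroup (X i)] [∀ i, Module A (X i)] (h : IsDirectSummand A M (∀ i, X i)) :
    ∃ i, IsDirectSummand A M (X i) := by
  classical
  have := Fintype.ofFinite ι
  have : Nontrivial M := ((indecomposable_iff M).mp hM).1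
  obtain ⟨j, p, hjp⟩ := h
  let φ (i : ι) : Module.End A M := p ∘ₗ LinearMap.single A X i ∘ₗ LinearMap.proj i ∘ₗ j
  have hadd (a b : Module.End A M) (hab : IsUnit (a + b)) : IsUnit a ∨ IsUnit b := by
    obtain ⟨v, hv⟩ := hab
    have h1 : 1 - a * ↑v⁻¹ = b * ↑v⁻¹ := by
      rw [sub_eq_iff_eq_add', ← add_mul, ← hv, Units.mul_inv]
    rcases hM.isUnit_or_isUnit_one_sub (a * ↑v⁻¹) with h | h
    · exact .inl ((Units.isUnit_mul_units _ _).mp h)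
    · rw [h1] at h
      exact .inr ((Units.isUnit_mul_units _ _).mp h)
  have hsum (s : Finset ι) : IsUnit (∑ i ∈ s, φ i) → ∃ i, IsUnit (φ i) := by
    induction s using Finset.induction_on with
    | empty => simp
    | insert i s hi ih =>
      rw [Finset.sum_insert hi]
      intro h
      exact (hadd _ _ h).elim (fun h => ⟨i, h⟩) ih
  have hone : ∑ i, φ i = 1 := by
    ext x
    have h1 : ∑ i, (Pi.single i (j x i) : ∀ i, X i) = j x := Finset.univ_sum_single _
    have h2 : p (j x) = x := LinearMap.congr_fun hjp x
    simp [φ, ← map_sum, h1, h2]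
  obtain ⟨i, hi⟩ := hsum Finset.univ (by rw [hone]; exact isUnit_one)
  obtain ⟨w, hw⟩ := hi
  refine ⟨i, LinearMap.proj i ∘ₗ j,
    (↑w⁻¹ : Module.End A M) ∘ₗ p ∘ₗ LinearMap.single A X i, ?_⟩
  change (↑w⁻¹ : Module.End A M) * φ i = 1
  rw [← hw, Units.inv_mul]

/-! ### Descent along the completion -/

/-- The properties of the completion of a Noetherian local ring `R` relating the finitely generated
modules over `R` and over `S`. -/
class IsLocalCompletion (R S : Type*) [CommRing R] [CommRing S] [Algebra R S] [IsLocalRing R]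
    [IsLocalRing S] : Prop where
  flat : Module.Flat R S
  maximalIdeal_eq_map :
    IsLocalRing.maximalIdeal S = (IsLocalRing.maximalIdeal R).map (algebraMap R S)
  exists_sub_mem (k : ℕ) (s : S) : ∃ r : R, s - algebraMap R S r ∈ IsLocalRing.maximalIdeal S ^ k
  isAdicComplete : IsAdicComplete (IsLocalRing.maximalIdeal S) S

attribute [instance] IsLocalCompletion.flat IsLocalCompletion.isAdicComplete

instance AdicCompletion.isLocalCompletion (R : Type*) [CommRing R] [IsLocalRing R]
    [IsNoetherianRing R] :
    IsLocalCompletion R (AdicCompletion (IsLocalRing.maximalIdeal R) R) where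
  flat := inferInstance
  maximalIdeal_eq_map := AdicCompletion.maximalIdeal_eq_map
  exists_sub_mem k s := by
    -- Any lift of the `k`-th component of `s` works, because the `k`-th power of the maximal ideal
    -- of the completion is the kernel of evaluation at level `k`.
    obtain ⟨r, hr⟩ := Ideal.Quotient.mk_surjective (s.1 k)
    refine ⟨r, ?_⟩
    rw [AdicCompletion.maximalIdeal_eq_map, ← Ideal.map_pow, ← Submodule.restrictScalars_mem R,
      ← Ideal.smul_top_eq_map, AdicCompletion.algebraMap_apply,
      AdicCompletion.pow_smul_top_eq_ker_eval (IsLocalRing.maximalIdeal R).fg_of_isNoetherianRing]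
    simpa [AdicCompletion.eval, sub_eq_zero] using hr.symm
  isAdicComplete := inferInstance

section
open TensorProduct IsLocalRing

/-- A module of finite length over a local ring is killed by a power of the maximal ideal. -/
theorem IsFiniteLength.exists_forall_smul_eq_zero {A : Type*} [CommRing A] [IsLocalRing A]
    {M : Type*} [AddCommGroup M] [Module A M] (hM : IsFiniteLength A M) :
    ∃ k : ℕ, ∀ a ∈ maximalIdeal A ^ k, ∀ x : M, a • x = 0 := by
  obtain ⟨_, _⟩ := isFiniteLength_iff_isNoetherian_isArtinian.mp hM
  let f : ℕ →o (Submodule A M)ᵒᵈ :=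
    ⟨fun k => OrderDual.toDual (maximalIdeal A ^ k • ⊤),
      fun _ _ h => Submodule.smul_mono (Ideal.pow_le_pow_right h) le_rfl⟩
  -- The descending chain of the `maximalIdeal A ^ k • ⊤` stabilises, and Nakayama makes the stable
  -- value zero.
  obtain ⟨k, hk⟩ := IsArtinian.monotone_stabilizes f
  have h : maximalIdeal A ^ k • (⊤ : Submodule A M) = maximalIdeal A ^ (k + 1) • ⊤ :=
    hk (k + 1) k.le_succ
  have hbot := Submodule.eq_bot_of_le_smul_of_le_jacobson_bot (maximalIdeal A)
    (maximalIdeal A ^ k • (⊤ : Submodule A M)) (IsNoetherian.noetherian _)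
    (by rw [← Submodule.mul_smul, ← pow_succ', ← h])
    (IsLocalRing.maximalIdeal_le_jacobson ⊥)
  refine ⟨k, fun a ha x => ?_⟩
  rw [← Submodule.mem_bot A, ← hbot]
  exact Submodule.smul_mem_smul ha trivial

variable (R S : Type*) [CommRing R] [CommRing S] [Algebra R S] [IsLocalRing R] [IsLocalRing S]
  [IsLocalCompletion R S]

namespace IsLocalCompletion

theorem isLocalHom : IsLocalHom (algebraMap R S) := by
  refine ((IsLocalRing.local_hom_TFAE _).out 0 2).mpr ?_
  rw [maximalIdeal_eq_map (R := R) (S := S)]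

theorem faithfullyFlat : Module.FaithfullyFlat R S := by
  have := isLocalHom R S
  exact Module.FaithfullyFlat.of_flat_of_isLocalHom

variable {R S}
variable {M N : Type*} [AddCommGroup M] [AddCommGroup N] [Module R M] [Module R N]

/-- A map between base changes is congruent modulo the maximal ideal to a base change of a map. -/
theorem exists_baseChange_sub_mem [IsNoetherianRing R] [Module.Finite R M] (f : S ⊗[R] M →ₗ[S] S ⊗[R] N) :
    ∃ f₀ : M →ₗ[R] N, ∀ x, f x - f₀.baseChange S x ∈
      maximalIdeal S • (⊤ : Submodule S (S ⊗[R] N)) := by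
  have : Module.FinitePresentation R M := Module.finitePresentation_of_finite R M
  -- Since `M` is finitely presented and `S` is flat, `Hom` commutes with base change; it remains to
  -- approximate scalars of `S` by elements of `R` modulo the maximal ideal.
  induction f using (Module.FinitePresentation.isBaseChange_map R M N S).inductionOn with
  | zero => exact ⟨0, by simp⟩
  | tmul f₀ => exact ⟨f₀, by simp⟩
  | smul s f h =>
    obtain ⟨f₀, h⟩ := h
    obtain ⟨r, hr⟩ := exists_sub_mem (R := R) 1 s
    rw [pow_one] at hr
    refine ⟨r • f₀, fun x => ?_⟩
    have : (s • f) x - (r • f₀).baseChange S x =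
        s • (f x - f₀.baseChange S x) + (s - algebraMap R S r) • f₀.baseChange S x := by
      rw [LinearMap.baseChange_smul, LinearMap.smul_apply, LinearMap.smul_apply, smul_sub,
        sub_smul s (algebraMap R S r) (f₀.baseChange S x), algebraMap_smul]
      abel
    rw [this]
    exact add_mem (Submodule.smul_mem _ _ (h x)) (Submodule.smul_mem_smul hr trivial)
  | add f g hf hg =>
    obtain ⟨f₀, hf⟩ := hf
    obtain ⟨g₀, hg⟩ := hg
    refine ⟨f₀ + g₀, fun x => ?_⟩
    rw [LinearMap.baseChange_add, LinearMap.add_apply, LinearMap.add_apply, add_sub_add_comm]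
    exact add_mem (hf x) (hg x)

/-- The splitting maps are approximated by `f₀` and `g₀` over `R`. The base change of `g₀ ∘ f₀` is
congruent to the identity, hence surjective by Nakayama; faithful flatness makes `g₀ ∘ f₀` a
surjective endomorphism of a finite module, so an automorphism, whose inverse corrects `g₀`. -/
theorem isDirectSummand_of_baseChange [IsNoetherianRing R] [Module.Finite R M]
    [Module.Finite R N]
    (h : IsDirectSummand S (S ⊗[R] M) (S ⊗[R] N)) : IsDirectSummand R M N := by
  obtain ⟨f, g, hgf⟩ := h
  obtain ⟨f₀, hf⟩ := exists_baseChange_sub_mem f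
  obtain ⟨g₀, hg⟩ := exists_baseChange_sub_mem g
  have hsurj : Function.Surjective ((g₀ ∘ₗ f₀).baseChange S) := by
    refine LinearMap.surjective_of_forall_sub_mem (f := LinearMap.id) Function.surjective_id
      fun x => ?_
    have h1 : g (f x) = x := LinearMap.congr_fun hgf x
    have h2 := Submodule.mem_map_of_mem (f := g₀.baseChange S) (hf x)
    rw [Submodule.map_smul''] at h2
    have h3 := add_mem (hg (f x)) (Submodule.smul_mono le_rfl le_top h2)
    rwa [map_sub, sub_add_sub_cancel, h1, ← LinearMap.comp_apply,
      ← LinearMap.baseChange_comp] at h3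
  have := faithfullyFlat R S
  have hbij : Function.Bijective (g₀ ∘ₗ f₀) :=
    OrzechProperty.bijective_of_surjective_endomorphism _
      ((Module.FaithfullyFlat.lTensor_surjective_iff_surjective R S _).mp hsurj)
  let e := LinearEquiv.ofBijective _ hbij
  refine ⟨f₀, e.symm ∘ₗ g₀, LinearMap.ext fun x => ?_⟩
  exact e.symm_apply_apply x

theorem exists_eq_one_tmul {k : ℕ} (h : ∀ a ∈ maximalIdeal R ^ k, ∀ x : M, a • x = 0)
    (z : S ⊗[R] M) : ∃ x : M, z = 1 ⊗ₜ[R] x := by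
  induction z with
  | zero => exact ⟨0, by simp⟩
  | add z w hz hw =>
    obtain ⟨x, rfl⟩ := hz
    obtain ⟨y, rfl⟩ := hw
    exact ⟨x + y, (TensorProduct.tmul_add _ _ _).symm⟩
  | tmul s x =>
    obtain ⟨r, hr⟩ := exists_sub_mem (R := R) k s
    rw [maximalIdeal_eq_map (R := R), ← Ideal.map_pow] at hr
    refine ⟨r • x, ?_⟩
    rw [← TensorProduct.smul_tmul, ← sub_eq_zero, ← TensorProduct.sub_tmul,
      ← Algebra.algebraMap_eq_smul_one]
    generalize s - algebraMap R S r = t at hr ⊢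
    induction hr using Submodule.span_induction with
    | mem b hb =>
      obtain ⟨a, ha, rfl⟩ := hb
      rw [Algebra.algebraMap_eq_smul_one, TensorProduct.smul_tmul, h a ha,
        TensorProduct.tmul_zero]
    | zero => exact TensorProduct.zero_tmul _ _
    | add b c _ _ hb hc => rw [TensorProduct.add_tmul, hb, hc, add_zero]
    | smul c b _ hb => rw [← TensorProduct.smul_tmul', hb, smul_zero]

/-- A power of the maximal ideal kills `X`, so each scalar of `S` acts as some scalar of `R`. Hence
`R`-submodules are `S`-submodules, and every tensor in `S ⊗ X` has the form `1 ⊗ x`. -/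
theorem isFiniteLength_restrictScalars {X : Type*} [AddCommGroup X] [Module R X] [Module S X]
    [IsScalarTower R S X] (hX : IsFiniteLength S X) :
    IsFiniteLength R X ∧ Nonempty (S ⊗[R] X ≃ₗ[S] X) := by
  obtain ⟨k, hk⟩ := hX.exists_forall_smul_eq_zero
  have hsmul (s : S) : ∃ r : R, ∀ x : X, s • x = r • x := by
    obtain ⟨r, hr⟩ := exists_sub_mem (R := R) k s
    refine ⟨r, fun x => ?_⟩
    rw [← sub_eq_zero, ← algebraMap_smul S r x, ← sub_smul, hk _ hr]
  constructor
  · let φ (W : Submodule R X) : Submodule S X :=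
      { W with
        smul_mem' := fun s x hx => by
          obtain ⟨r, hr⟩ := hsmul s
          rw [hr]
          exact W.smul_mem r hx }
    have hφ : StrictMono φ := fun _ _ h => h
    rw [isFiniteLength_iff_isNoetherian_isArtinian] at hX ⊢
    obtain ⟨h1, h2⟩ := hX
    rw [isNoetherian_iff'] at h1 ⊢
    exact ⟨hφ.wellFoundedGT, hφ.wellFoundedLT⟩
  · have hk' (a : R) (ha : a ∈ maximalIdeal R ^ k) (x : X) : a • x = 0 := by
      rw [← algebraMap_smul S a x]
      refine hk _ ?_ x
      rw [maximalIdeal_eq_map (R := R), ← Ideal.map_pow]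
      exact Ideal.mem_map_of_mem _ ha
    let F := (TensorProduct.isBaseChange R X S).lift (LinearMap.id : X →ₗ[R] X)
    have hF (x : X) : F (1 ⊗ₜ x) = x := (TensorProduct.isBaseChange R X S).lift_eq _ x
    refine ⟨LinearEquiv.ofBijective F ⟨?_, fun x => ⟨_, hF x⟩⟩⟩
    intro z w hzw
    obtain ⟨x, rfl⟩ := exists_eq_one_tmul hk' z
    obtain ⟨y, rfl⟩ := exists_eq_one_tmul hk' w
    rw [hF, hF] at hzw
    rw [hzw]

theorem isFiniteLength_baseChange (hM : IsFiniteLength R M) : IsFiniteLength S (S ⊗[R] M) := by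
  obtain ⟨k, hk⟩ := hM.exists_forall_smul_eq_zero
  have := hM.of_surjective (f := TensorProduct.mk R S M 1) fun z => by
    obtain ⟨x, rfl⟩ := exists_eq_one_tmul hk z
    exact ⟨x, rfl⟩
  rw [isFiniteLength_iff_isNoetherian_isArtinian] at this ⊢
  exact ⟨isNoetherian_of_tower R this.1, isArtinian_of_tower R this.2⟩

end IsLocalCompletion

/-! ### Syzygies and base change -/

/-- Surjections from a finitely generated projective module which are congruent modulo the maximal
ideal have isomorphic kernels. -/
theorem LinearMap.nonempty_ker_equiv_of_forall_sub_mem {A : Type*} [CommRing A] [IsLocalRing A]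
    {F K : Type*} [AddCommGroup F] [AddCommGroup K] [Module A F] [Module A K] [Module.Finite A F]
    [Module.Projective A F] {f g : F →ₗ[A] K} (hg : Function.Surjective g)
    (h : ∀ x, f x - g x ∈ maximalIdeal A • (⊤ : Submodule A K)) :
    Nonempty (LinearMap.ker f ≃ₗ[A] LinearMap.ker g) := by
  have hmap : (maximalIdeal A • (⊤ : Submodule A F)).map g = maximalIdeal A • ⊤ := by
    rw [Submodule.map_smul'', Submodule.map_top, LinearMap.range_eq_top.mpr hg]
  let g' : (maximalIdeal A • (⊤ : Submodule A F) : Submodule A F) →ₗ[A]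
      (maximalIdeal A • (⊤ : Submodule A K) : Submodule A K) :=
    g.restrict fun x hx => hmap ▸ Submodule.mem_map_of_mem hx
  have hg' : Function.Surjective g' := by
    rintro ⟨y, hy⟩
    rw [← hmap] at hy
    obtain ⟨x, hx, rfl⟩ := hy
    exact ⟨⟨x, hx⟩, rfl⟩
  -- Lifting `f - g` through `g` with values in `maximalIdeal A • ⊤` gives `f = g ∘ (1 + d)`, where
  -- `1 + d` is an automorphism by Nakayama and carries `ker f` onto `ker g`.
  obtain ⟨d, hd⟩ := Module.projective_lifting_property g' ((f - g).codRestrict _ h) hg'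
  let φ : Module.End A F := 1 + Submodule.subtype _ ∘ₗ d
  have hφ : g ∘ₗ φ = f := by
    ext x
    have := congrArg Subtype.val (LinearMap.congr_fun hd x)
    simp only [LinearMap.comp_apply, LinearMap.codRestrict_apply, LinearMap.sub_apply] at this
    change g (x + (d x).1) = f x
    rw [map_add, add_comm, ← eq_sub_iff_add_eq]
    exact this
  have hunit : IsUnit φ := by
    refine Module.End.isUnit_of_forall_sub_mem (f := 1) isUnit_one fun x => ?_
    have : (1 : Module.End A F) x - φ x = - (d x).1 := by simp [φ]
    rw [this]
    exact neg_mem (d x).2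
  let e := LinearEquiv.ofBijective φ ((Module.End.isUnit_iff φ).mp hunit)
  refine ⟨e.ofSubmodules _ _ ?_⟩
  ext y
  obtain ⟨x, rfl⟩ := e.surjective y
  have : g (e x) = f x := LinearMap.congr_fun hφ x
  simp [this]

end

section
open TensorProduct

theorem Module.Flat.nonempty_baseChange_ker_equiv {R : Type*} (S : Type*) [CommRing R] [CommRing S]
    [Algebra R S] [Module.Flat R S] {F K : Type*} [AddCommGroup F] [AddCommGroup K] [Module R F]
    [Module R K] (g : F →ₗ[R] K) :
    Nonempty (S ⊗[R] LinearMap.ker g ≃ₗ[S] LinearMap.ker (g.baseChange S)) := by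
  let j := (LinearMap.ker g).subtype
  have hj : Function.Injective (j.baseChange S) :=
    Module.Flat.lTensor_preserves_injective_linearMap j (Submodule.injective_subtype _)
  have hex : Function.Exact (j.baseChange S) (g.baseChange S) :=
    Module.Flat.lTensor_exact S (LinearMap.exact_subtype_ker_map g)
  exact ⟨(LinearEquiv.ofInjective _ hj).trans
    (LinearEquiv.ofEq _ _ hex.linearMap_ker_eq.symm)⟩

namespace SyzygyRep

theorem IsFirstSyzygy.of_linearEquiv {A : Type u} [CommRing A] {N N' K K' : ModuleCat.{u} A}
    (h : IsFirstSyzygy N K) (e : N ≃ₗ[A] N') (e' : K ≃ₗ[A] K') : IsFirstSyzygy N' K' := by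
  obtain ⟨P, f, g, hfin, hproj, hf, hfg, hg⟩ := h
  refine ⟨P, f ∘ₗ e.symm, e' ∘ₗ g, hfin, hproj, hf.comp e.symm.injective, fun x => ?_,
    e'.surjective.comp hg⟩
  simp only [LinearMap.comp_apply, LinearEquiv.coe_coe, EmbeddingLike.map_eq_zero_iff, hfg x]
  exact ⟨fun ⟨y, hy⟩ => ⟨e y, by simpa using hy⟩, fun ⟨y, hy⟩ => ⟨e.symm y, hy⟩⟩

theorem IsSyzygy.of_linearEquiv {A : Type u} [CommRing A] {n : ℕ} {N N' X : ModuleCat.{u} A}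
    (h : IsSyzygy n N X) (e : N ≃ₗ[A] N') : IsSyzygy n N' X := by
  cases n with
  | zero =>
    obtain ⟨f⟩ := h
    exact ⟨e.symm.toModuleIso ≪≫ f⟩
  | succ n =>
    obtain ⟨K, hK, hN⟩ := h
    exact ⟨K, hK, hN.of_linearEquiv e (LinearEquiv.refl _ _)⟩

section Flat

variable {R S : Type u} [CommRing R] [CommRing S] [Algebra R S] [Module.Flat R S]

theorem IsFirstSyzygy.baseChange {N K : ModuleCat.{u} R} (h : IsFirstSyzygy N K) :
    IsFirstSyzygy (ModuleCat.of S (S ⊗[R] N)) (ModuleCat.of S (S ⊗[R] K)) := by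
  obtain ⟨P, f, g, hfin, hproj, hf, hfg, hg⟩ := h
  exact ⟨ModuleCat.of S (S ⊗[R] P), f.baseChange S, g.baseChange S,
    inferInstanceAs (Module.Finite S (S ⊗[R] P)), inferInstanceAs (Module.Projective S (S ⊗[R] P)),
    Module.Flat.lTensor_preserves_injective_linearMap f hf, Module.Flat.lTensor_exact S hfg,
    LinearMap.lTensor_surjective S hg⟩

theorem IsSyzygy.baseChange {n : ℕ} {N X : ModuleCat.{u} R} (h : IsSyzygy n N X) :
    IsSyzygy n (ModuleCat.of S (S ⊗[R] N)) (ModuleCat.of S (S ⊗[R] X)) := by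
  induction n generalizing N with
  | zero =>
    obtain ⟨f⟩ := h
    exact ⟨(f.toLinearEquiv.baseChange R S).toModuleIso⟩
  | succ n ih =>
    obtain ⟨K, hK, hN⟩ := h
    exact ⟨_, ih hK, hN.baseChange⟩

end Flat

variable {R S : Type u} [CommRing R] [CommRing S] [Algebra R S] [IsLocalRing R] [IsLocalRing S]
  [IsLocalCompletion R S]

/-- First syzygies of base changes are base changes of first syzygies. -/
theorem IsFirstSyzygy.exists_of_baseChange [IsNoetherianRing R] {N : ModuleCat.{u} S}
    {K : ModuleCat.{u} R} [Module.Finite R K]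
    (h : IsFirstSyzygy N (ModuleCat.of S (S ⊗[R] K))) :
    ∃ N₀ : ModuleCat.{u} R, Module.Finite R N₀ ∧ IsFirstSyzygy N₀ K ∧
      Nonempty (S ⊗[R] N₀ ≃ₗ[S] N) := by
  obtain ⟨P, f, g, hfin, hproj, hf, hfg, hg⟩ := h
  -- Over a local ring `P` is free, hence itself a base change from `R`; only the map `g` has to be
  -- approximated.
  have : Module.Free S P := Module.free_of_flat_of_isLocalRing
  let ι := Module.Free.ChooseBasisIndex S P
  let e : S ⊗[R] (ι →₀ R) ≃ₗ[S] P :=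
    ((Algebra.TensorProduct.basis S Finsupp.basisSingleOne).repr).trans
      (Module.Free.chooseBasis S P).repr.symm
  let g₁ : S ⊗[R] (ι →₀ R) →ₗ[S] S ⊗[R] K := g ∘ₗ e
  have hg₁ : Function.Surjective g₁ := hg.comp e.surjective
  obtain ⟨g₀, hg₀⟩ := IsLocalCompletion.exists_baseChange_sub_mem g₁
  have hsurj := LinearMap.surjective_of_forall_sub_mem hg₁ hg₀
  have := IsLocalCompletion.faithfullyFlat R S
  have hsurj₀ : Function.Surjective g₀ :=
    (Module.FaithfullyFlat.lTensor_surjective_iff_surjective R S _).mp hsurj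
  obtain ⟨e₁⟩ := LinearMap.nonempty_ker_equiv_of_forall_sub_mem hsurj hg₀
  obtain ⟨e₀⟩ := Module.Flat.nonempty_baseChange_ker_equiv S g₀
  have e₂ : LinearMap.ker g ≃ₗ[S] LinearMap.ker g₁ := by
    refine (e.symm.ofSubmodules _ _ ?_)
    ext x
    simp [g₁]
  refine ⟨ModuleCat.of R (LinearMap.ker g₀), inferInstanceAs (Module.Finite R (LinearMap.ker g₀)),
    ⟨ModuleCat.of R (ι →₀ R), (LinearMap.ker g₀).subtype, g₀, inferInstanceAs (Module.Finite R (ι →₀ R)),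
      inferInstanceAs (Module.Projective R (ι →₀ R)), Submodule.injective_subtype _,
      LinearMap.exact_subtype_ker_map g₀, hsurj₀⟩, ⟨?_⟩⟩
  exact e₀.trans <| e₁.symm.trans <| e₂.symm.trans <|
    (LinearEquiv.ofEq _ _ hfg.linearMap_ker_eq).trans (LinearEquiv.ofInjective f hf).symm

theorem IsSyzygy.exists_of_isFiniteLength [IsNoetherianRing R] {n : ℕ} {N X : ModuleCat.{u} S}
    (hX : IsFiniteLength S X) (h : IsSyzygy n N X) :
    ∃ N₀ : ModuleCat.{u} R, syzygies n (finiteLength R) N₀ ∧ Nonempty (S ⊗[R] N₀ ≃ₗ[S] N) := by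
  induction n generalizing N with
  | zero =>
    obtain ⟨f⟩ := h
    -- For `n = 0` the descended module is `X` with scalars restricted to `R`.
    let : Module R X := Module.compHom X (algebraMap R S)
    have : IsScalarTower R S X := .of_algebraMap_smul fun _ _ => rfl
    obtain ⟨hR, ⟨e⟩⟩ := IsLocalCompletion.isFiniteLength_restrictScalars (R := R) hX
    have := (isFiniteLength_iff_isNoetherian_isArtinian.mp hR).1
    exact ⟨ModuleCat.of R X, ⟨inferInstanceAs (Module.Finite R X), ModuleCat.of R X, hR,
      ⟨Iso.refl _⟩⟩, ⟨e.trans f.toLinearEquiv.symm⟩⟩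
  | succ n ih =>
    obtain ⟨K, hK, hN⟩ := h
    obtain ⟨K₀, ⟨hfin, X₀, hX₀, hK₀⟩, ⟨e⟩⟩ := ih hK
    obtain ⟨N₀, hfin', hN₀, he⟩ := IsFirstSyzygy.exists_of_baseChange
      (K := K₀) (hN.of_linearEquiv (K' := ModuleCat.of S (S ⊗[R] K₀)) (LinearEquiv.refl _ _) e.symm)
    exact ⟨N₀, ⟨hfin', X₀, hX₀, K₀, hK₀, hN₀⟩, he⟩

theorem addClosure_syzygies_baseChange {n : ℕ} {M : ModuleCat.{u} R}
    (h : addClosure (syzygies n (finiteLength R)) M) :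
    addClosure (syzygies n (finiteLength S)) (ModuleCat.of S (S ⊗[R] M)) := by
  obtain ⟨hfin, m, X, hX, hs⟩ := addClosure_iff.mp h
  refine addClosure_iff.mpr ⟨inferInstanceAs (Module.Finite S (S ⊗[R] M)), m,
    fun i => ModuleCat.of S (S ⊗[R] X i), fun i => ?_,
    (hs.baseChange S).trans (.of_equiv (TensorProduct.piRight R S S _))⟩
  obtain ⟨hfin, Y, hY, hXY⟩ := hX i
  exact ⟨inferInstanceAs (Module.Finite S (S ⊗[R] X i)), ModuleCat.of S (S ⊗[R] Y),
    IsLocalCompletion.isFiniteLength_baseChange hY, hXY.baseChange⟩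

theorem exists_isDirectSummand_baseChange [IsNoetherianRing R] {n : ℕ} {M : ModuleCat.{u} S}
    (h : addClosure (syzygies n (finiteLength S)) M) :
    ∃ (m : ℕ) (X : Fin m → ModuleCat.{u} R), (∀ i, syzygies n (finiteLength R) (X i)) ∧
      IsDirectSummand S M (∀ i, S ⊗[R] X i) := by
  obtain ⟨hfin, m, X, hX, hs⟩ := addClosure_iff.mp h
  have (i : Fin m) : ∃ N₀ : ModuleCat.{u} R,
      syzygies n (finiteLength R) N₀ ∧ Nonempty (S ⊗[R] N₀ ≃ₗ[S] X i) := by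
    obtain ⟨_, Y, hY, hXY⟩ := hX i
    exact hXY.exists_of_isFiniteLength hY
  choose X₀ hX₀ e using this
  exact ⟨m, X₀, hX₀, hs.trans (.of_equiv (LinearEquiv.piCongrRight fun i => (e i).some.symm))⟩

end SyzygyRep

end

/-! ### Multiplicity vectors and counting -/

section
open TensorProduct

/-- The two sums record fibre cardinalities, so the inequality gives an embedding of each fibre of
`f` into the matching fibre of `g`; these glue. It turns an inequality of multiplicities into a
matching of summands. -/
theorem Finsupp.exists_injective_of_sum_single_le {ι κ I : Type*} [Fintype ι] [Fintype κ]
    {f : ι → I} {g : κ → I}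
    (h : ∑ i, Finsupp.single (f i) 1 ≤ ∑ k, Finsupp.single (g k) (1 : ℕ)) :
    ∃ σ : ι → κ, Function.Injective σ ∧ ∀ i, g (σ i) = f i := by
  classical
  have hσ (x : I) : Nonempty ({i // f i = x} ↪ {k // g k = x}) := by
    have := h x
    simp only [Finsupp.finsetSum_apply, Finsupp.single_apply, Finset.sum_boole, Nat.cast_id] at this
    refine Function.Embedding.nonempty_of_card_le ?_
    rwa [Fintype.card_subtype, Fintype.card_subtype]
  let τ (x : I) := (hσ x).some
  refine ⟨fun i => (τ (f i) ⟨i, rfl⟩).1, fun i j hij => ?_, fun i => (τ (f i) ⟨i, rfl⟩).2⟩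
  have hf : f i = f j := by
    rw [← (τ (f i) ⟨i, rfl⟩).2, ← (τ (f j) ⟨j, rfl⟩).2]
    exact congrArg g hij
  have key (x : I) (hx : f i = x) : τ (f i) ⟨i, rfl⟩ = (τ x ⟨i, hx⟩).1 := by
    subst hx
    rfl
  have h1 : (τ (f j) ⟨i, hf⟩).1 = (τ (f j) ⟨j, rfl⟩).1 := (key _ hf).symm.trans hij
  exact congrArg Subtype.val ((τ (f j)).injective (Subtype.ext h1))

namespace SyzygyRep

theorem nonempty_linearEquiv_out {A : Type u} [CommRing A] (M : ModuleCat.{u} A) :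
    Nonempty ((Quotient.mk (isIsomorphicSetoid (ModuleCat.{u} A)) M).out ≃ₗ[A] M) := by
  obtain ⟨e⟩ := Quotient.mk_out (s := isIsomorphicSetoid (ModuleCat.{u} A)) M
  exact ⟨e.toLinearEquiv⟩

theorem addClosure_out_of_mem {A : Type u} [CommRing A] {𝒳 : ObjectProperty (ModuleCat.{u} A)}
    {c : Quotient (isIsomorphicSetoid (ModuleCat.{u} A))}
    (hc : c ∈ indecomposableClasses (addClosure 𝒳)) :
    addClosure 𝒳 c.out ∧ Indecomposable c.out := by
  obtain ⟨M, hM, hi, rfl⟩ := hc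
  obtain ⟨e⟩ := nonempty_linearEquiv_out M
  exact ⟨hM.of_isDirectSummand (.of_equiv e), (indecomposable_iff_of_linearEquiv e).mpr hi⟩

/-- By Krull–Schmidt, an indecomposable summand of `W` is isomorphic to a member of any fixed
decomposition of `W` into indecomposables. -/
theorem finite_indecomposable_isDirectSummand {A : Type u} [CommRing A] [IsLocalRing A]
    [IsAdicComplete (IsLocalRing.maximalIdeal A) A] (W : ModuleCat.{u} A) [Module.Finite A W] :
    {d : Quotient (isIsomorphicSetoid (ModuleCat.{u} A)) | ∃ M : ModuleCat.{u} A,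
      Indecomposable M ∧ IsDirectSummand A M W ∧ Quotient.mk _ M = d}.Finite := by
  obtain ⟨k, L, hL, ⟨e⟩⟩ := exists_linearEquiv_pi_indecomposable W
  refine (Set.finite_range fun i => Quotient.mk _ (L i)).subset ?_
  rintro _ ⟨M, hM, hs, rfl⟩
  have : Module.Finite A M := hs.finite
  have : Nontrivial M := ((indecomposable_iff M).mp hM).1
  obtain ⟨i, hi⟩ := hM.exists_isDirectSummand_of_pi (fun i => L i) (hs.trans (.of_equiv e))
  obtain ⟨f⟩ := (hL i).nonempty_linearEquiv_of_isDirectSummand hi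
  exact ⟨i, Quotient.sound ⟨f.symm.toModuleIso⟩⟩

variable (R S : Type u) [CommRing R] [CommRing S] [Algebra R S] [IsLocalRing R] [IsLocalRing S]
  [IsLocalCompletion R S] [IsNoetherianRing R] (n : ℕ)

/-- Each indecomposable over the completion is a summand of the base change of an indecomposable. -/
theorem indecomposableClasses_subset_biUnion :
    indecomposableClasses (addClosure (syzygies n (finiteLength S))) ⊆
      ⋃ c ∈ indecomposableClasses (addClosure (syzygies n (finiteLength R))),
        {d | ∃ M : ModuleCat.{u} S, Indecomposable M ∧
          IsDirectSummand S M (S ⊗[R] c.out) ∧ Quotient.mk _ M = d} := by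
  rintro _ ⟨M, hM, hi, rfl⟩
  have : Module.Finite S M := hM.1
  obtain ⟨m, X, hX, hs⟩ := exists_isDirectSummand_baseChange (R := R) hM
  obtain ⟨i, hs⟩ := hi.exists_isDirectSummand_of_pi _ hs
  have : Module.Finite R (X i) := (hX i).1
  obtain ⟨k, L, hL, ⟨e⟩⟩ := exists_linearEquiv_pi_indecomposable (X i)
  obtain ⟨j, hs⟩ := hi.exists_isDirectSummand_of_pi (fun j => S ⊗[R] L j)
    (hs.trans (.of_equiv ((e.baseChange R S).trans (TensorProduct.piRight R S S _))))
  have hLX : IsDirectSummand R (L j) (X i) :=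
    (IsDirectSummand.single (fun j => L j) j).trans (.of_equiv e.symm)
  have hXi : addClosure (syzygies n (finiteLength R)) (X i) :=
    addClosure_iff.mpr ⟨this, 1, fun _ => X i, fun _ => hX i,
      IsDirectSummand.single (fun _ : Fin 1 => X i) 0⟩
  refine Set.mem_biUnion ⟨L j, hXi.of_isDirectSummand hLX, hL j, rfl⟩
    ⟨M, hi, hs.trans ?_, rfl⟩
  obtain ⟨f⟩ := nonempty_linearEquiv_out (L j)
  exact .of_equiv (f.symm.baseChange R S)

/-- The multiplicities of the indecomposable summands of the base change. -/
theorem exists_multiplicity :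
    ∃ F : indecomposableClasses (addClosure (syzygies n (finiteLength R))) →
        (indecomposableClasses (addClosure (syzygies n (finiteLength S))) →₀ ℕ),
      ∀ c c', F c ≤ F c' → c = c' := by
  have key (c : indecomposableClasses (addClosure (syzygies n (finiteLength R)))) :
      ∃ (k : ℕ) (d : Fin k → indecomposableClasses (addClosure (syzygies n (finiteLength S)))),
        Nonempty ((S ⊗[R] c.1.out) ≃ₗ[S] ∀ i, (d i).1.out) := by
    have hc := addClosure_syzygies_baseChange (S := S) (addClosure_out_of_mem c.2).1
    have := hc.1
    obtain ⟨k, L, hL, ⟨e⟩⟩ := exists_linearEquiv_pi_indecomposable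
      (ModuleCat.of S (S ⊗[R] c.1.out))
    refine ⟨k, fun i => ⟨Quotient.mk _ (L i), L i, hc.of_isDirectSummand
      ((IsDirectSummand.single (fun j => L j) i).trans (.of_equiv e.symm)), hL i, rfl⟩, ⟨?_⟩⟩
    exact e.trans (LinearEquiv.piCongrRight fun i => (nonempty_linearEquiv_out (L i)).some.symm)
  -- An arbitrary decomposition of each base change is fixed; uniqueness of the multiplicities plays
  -- no role below.
  choose k d e using key
  refine ⟨fun c => ∑ i, Finsupp.single (d c i) 1, fun c c' h => Subtype.ext ?_⟩
  obtain ⟨σ, hσ, hd⟩ := Finsupp.exists_injective_of_sum_single_le h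
  have hs : IsDirectSummand S (S ⊗[R] c.1.out) (S ⊗[R] c'.1.out) :=
    (IsDirectSummand.of_equiv (e c).some).trans <|
      (IsDirectSummand.pi _ _ σ hσ fun i => by
        rw [hd i]
        exact .of_equiv (LinearEquiv.refl _ _)).trans (.of_equiv (e c').some.symm)
  obtain ⟨hc, hci⟩ := addClosure_out_of_mem c.2
  obtain ⟨hc', hci'⟩ := addClosure_out_of_mem c'.2
  have := hc.1
  have := hc'.1
  have : Nontrivial c.1.out := ((indecomposable_iff _).mp hci).1
  obtain ⟨f⟩ := hci'.nonempty_linearEquiv_of_isDirectSummand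
    (IsLocalCompletion.isDirectSummand_of_baseChange hs)
  rw [← Quotient.out_eq c.1, ← Quotient.out_eq c'.1]
  exact Quotient.sound ⟨f.toModuleIso⟩

theorem hasFiniteRepType_iff :
    HasFiniteRepType (addClosure (syzygies n (finiteLength R))) ↔
      HasFiniteRepType (addClosure (syzygies n (finiteLength S))) := by
  constructor
  · intro h
    refine (h.biUnion fun c hc => ?_).subset (indecomposableClasses_subset_biUnion R S n)
    have := (addClosure_out_of_mem hc).1.1
    exact finite_indecomposable_isDirectSummand (ModuleCat.of S (S ⊗[R] c.out))
  · intro h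
    obtain ⟨F, hF⟩ := exists_multiplicity R S n
    have : Finite (indecomposableClasses (addClosure (syzygies n (finiteLength S)))) := h
    -- Over a finite index set the vectors are well quasi-ordered (Dickson's lemma), so an antichain
    -- of them is finite.
    have hanti : IsAntichain (· ≤ ·) (Set.range F) := by
      rintro _ ⟨c, rfl⟩ _ ⟨c', rfl⟩ hne hle
      exact hne (congrArg F (hF c c' hle))
    have := (WellQuasiOrderedLE.finite_of_isAntichain hanti).to_subtype
    exact Finite.of_injective (Set.rangeFactorization F)
      fun c c' h => hF c c' (congrArg Subtype.val h).le

theorem hasCountableRepType_iff :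
    HasCountableRepType (addClosure (syzygies n (finiteLength R))) ↔
      HasCountableRepType (addClosure (syzygies n (finiteLength S))) := by
  constructor
  · intro h
    refine (Set.Countable.biUnion h fun c hc => ?_).mono
      (indecomposableClasses_subset_biUnion R S n)
    have := (addClosure_out_of_mem hc).1.1
    exact (finite_indecomposable_isDirectSummand (ModuleCat.of S (S ⊗[R] c.out))).countable
  · intro h
    obtain ⟨F, hF⟩ := exists_multiplicity R S n
    have : Countable (indecomposableClasses (addClosure (syzygies n (finiteLength S)))) := h
    have hinj : Function.Injective F := fun c c' h => hF c c' h.le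
    exact hinj.countable

end SyzygyRep

end

theorem mainTheorem11 (R : Type u) [CommRing R] [IsLocalRing R] [IsNoetherianRing R] (n : ℕ) :
    (SyzygyRep.HasFiniteRepType
        (SyzygyRep.addClosure (SyzygyRep.syzygies n (SyzygyRep.finiteLength R))) ↔
      SyzygyRep.HasFiniteRepType
        (SyzygyRep.addClosure (SyzygyRep.syzygies n (SyzygyRep.finiteLength
          (AdicCompletion (IsLocalRing.maximalIdeal R) R))))) ∧
    (SyzygyRep.HasCountableRepType
        (SyzygyRep.addClosure (SyzygyRep.syzygies n (SyzygyRep.finiteLength R))) ↔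
      SyzygyRep.HasCountableRepType
        (SyzygyRep.addClosure (SyzygyRep.syzygies n (SyzygyRep.finiteLength
          (AdicCompletion (IsLocalRing.maximalIdeal R) R))))) :=
  ⟨SyzygyRep.hasFiniteRepType_iff R _ n, SyzygyRep.hasCountableRepType_iff R _ n⟩
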